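/- Let $n\ge 0$ and $r\ge 1$ be integers, let $A,A_d\in\mathbb R^{n\times n}$, and consider, for a constant delay $h\ge 0$, the linear time-delay system $$\dot x(t)=Ax(t)+A_d\,x(t-h)\quad(t\ge 0),\qquad x(\theta)=\phi(\theta)\quad(\theta\in[-h,0]),$$ with $\phi:[-h,0]\to\mathbb R^n$ continuous (no input and no disturbance). Suppose that there are symmetric positive definite matrices $P,R\in\mathbb R^{n\times n}$ and $Q\in\mathbb R^{rn\times rn}$ and a scalar $h_m>0$ such that $$(S^{\perp})^{T}\,\Gamma\,S^{\perp}<0$$ (negative definite). Here $S=\begin{bmatrix}-\mathbf 1 & A & 0_{n\times(r-1)n} & A_d\end{bmatrix}\in\mathbb R^{n\times(r+2)n}$, $S^\perp$ is a matrix whose columns form a basis of $\ker S$, and $\Gamma\in\mathbb R^{(r+2)n\times(r+2)n}$ is the symmetric matrix $$\Gamma=\begin{bmatrix}\Gamma_0&0\\0&0_{(r-1)n}\end{bmatrix}+\begin{bmatrix}0_{n}&0&0\\0&Q&0\\0&0&0_{n}\end{bmatrix}-\begin{bmatrix}0_{2n}&0\\0&Q\end{bmatrix},\qquad \Gamma_0=\begin{bmatrix}\frac{h_m}{r}R&P&0\\P&-\frac{r}{h_m}R&\frac{r}{h_m}R\\0&\frac{r}{h_m}R&-\frac{r}{h_m}R\end{bmatrix}\in\mathbb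 R^{3n\times 3n}.$$ Then for every delay $h$ with $0\le h\le h_m$ the system is asymptotically stable: for every $\varepsilon>0$ there is $\delta>0$ such that every solution with $\sup_{\theta\in[-h,0]}\|\phi(\theta)\|<\delta$ satisfies $\|x(t)\|<\varepsilon$ for all $t\ge 0$, and every solution, for every continuous $\phi$, satisfies $x(t)\to 0$ as $t\to\infty$. -/

import Mathlib

open Set Filter Topology

namespace TimeDelay

/-- Continuous-time trajectories of `x' (t) = A x(t) + Ad x(t - h)` for `t ≥ 0` with initial
condition `x(θ) = φ(θ)`, `θ ∈ [-h, 0]`, where `φ` is continuous on `[-h, 0]`.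
At `t = 0` the derivative is the right derivative; values of `x` on `(-∞, -h)` and values of
`φ` outside `[-h, 0]` play no role. -/
structure IsSolution {n : ℕ} (A Ad : Matrix (Fin n) (Fin n) ℝ) (h : ℝ)
    (φ x : ℝ → Fin n → ℝ) : Prop where
  continuousOn_initial : ContinuousOn φ (Icc (-h) 0)
  continuousOn : ContinuousOn x (Ici (-h))
  initial : ∀ θ ∈ Icc (-h) 0, x θ = φ θ
  hasDeriv : ∀ t ∈ Ici (0 : ℝ),
    HasDerivWithinAt x (A.mulVec (x t) + Ad.mulVec (x (t - h))) (Ici 0) t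

/-- Asymptotic stability of the zero solution of `x' (t) = A x(t) + Ad x(t - h)`:
Lyapunov stability with respect to the uniform norm of the initial function, and convergence
to zero of every solution. The norm on `Fin n → ℝ` is the maximum norm, equivalent to the
Euclidean norm, so that the notion does not depend on the choice. -/
def IsAsymptoticallyStable {n : ℕ} (A Ad : Matrix (Fin n) (Fin n) ℝ) (h : ℝ) : Prop :=
  (∀ ε > 0, ∃ δ > 0, ∀ φ x : ℝ → Fin n → ℝ, IsSolution A Ad h φ x →
      (∀ θ ∈ Icc (-h) 0, ‖φ θ‖ < δ) → ∀ t ≥ 0, ‖x t‖ < ε) ∧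
    ∀ φ x : ℝ → Fin n → ℝ, IsSolution A Ad h φ x → Tendsto x atTop (𝓝 0)

/-- The `(i, j)` block, `0 ≤ i, j ≤ r + 1`, of the first term of `Γ`. -/
noncomputable def gammaBlock {n : ℕ} (r : ℕ) (P R : Matrix (Fin n) (Fin n) ℝ) (hm : ℝ) :
    ℕ → ℕ → Matrix (Fin n) (Fin n) ℝ
  | 0, 0 => (hm / (r : ℝ)) • R
  | 0, 1 => P
  | 1, 0 => P
  | 1, 1 => -(((r : ℝ) / hm) • R)
  | 1, 2 => ((r : ℝ) / hm) • R
  | 2, 1 => ((r : ℝ) / hm) • R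
  | 2, 2 => -(((r : ℝ) / hm) • R)
  | _, _ => 0

/-- The `rn × (r + 2)n` matrix selecting the blocks `k, k + 1, …, k + r - 1` of a vector
with `r + 2` blocks of size `n`. -/
noncomputable def blockSelect (n r k : ℕ) : Matrix (Fin r × Fin n) (Fin (r + 2) × Fin n) ℝ :=
  Matrix.of fun a b => if (b.1 : ℕ) = (a.1 : ℕ) + k ∧ b.2 = a.2 then 1 else 0

/-- The matrix `Γ`, of size `(r + 2)n`: the sum of the matrix with blocks `gammaBlock`, of `Q`
placed at the block rows and columns `1, …, r`, and of `-Q` placed at the block rows and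
columns `2, …, r + 1`, the blocks being numbered from `0`. -/
noncomputable def Gamma {n r : ℕ} (P R : Matrix (Fin n) (Fin n) ℝ)
    (Q : Matrix (Fin r × Fin n) (Fin r × Fin n) ℝ) (hm : ℝ) :
    Matrix (Fin (r + 2) × Fin n) (Fin (r + 2) × Fin n) ℝ :=
  Matrix.of (fun a b => gammaBlock r P R hm a.1 b.1 a.2 b.2)
    + (blockSelect n r 1).transpose * Q * blockSelect n r 1
    - (blockSelect n r 2).transpose * Q * blockSelect n r 2

/-- The matrix `S = [-1, A, 0, …, 0, Ad]`, of size `n × (r + 2)n`, with `r - 1` zero blocks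
(for `r ≥ 1`). -/
def S {n : ℕ} (r : ℕ) (A Ad : Matrix (Fin n) (Fin n) ℝ) :
    Matrix (Fin n) (Fin (r + 2) × Fin n) ℝ :=
  Matrix.of fun i b =>
    if (b.1 : ℕ) = 0 then (-1 : Matrix (Fin n) (Fin n) ℝ) i b.2
    else if (b.1 : ℕ) = 1 then A i b.2
    else if (b.1 : ℕ) = r + 1 then Ad i b.2
    else 0

/-- `N` is a right orthogonal complement of `M`: its columns form a basis of the
kernel of `M`. -/
def IsRightComplement {ι κ : Type*} [Fintype κ] {m : ℕ} (M : Matrix ι κ ℝ)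
    (N : Matrix κ (Fin m) ℝ) : Prop :=
  LinearIndependent ℝ N.col ∧ Submodule.span ℝ (range N.col) = LinearMap.ker M.mulVecLin

end TimeDelay

/-!
The proof is by a Lyapunov–Krasovskii functional. Put `τ = h / r` and let `X t` be the vector
stacking `x t, x (t - τ), …, x (t - (r - 1) τ)`. The functional is

`V t = x(t)ᵀ P x(t) + ∫_{t-τ}^t X(s)ᵀ Q X(s) ds + ∫_{t-τ}^t (s - t + τ) x'(s)ᵀ R x'(s) ds`.

Let `ζ` have the blocks `x' t, x t, x (t - τ), …, x (t - h)`. The system equation says that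
`S ζ = 0`. For `t > τ`, Jensen's inequality for `∫_{t-τ}^t x'ᵀ R x'` together with `τ ≤ hm / r`
bounds `V'` by `ζᵀ Γ ζ` (`deriv_lyapunov_le_quadForm_Gamma`), and the matrix inequality, made
uniform by compactness of the unit sphere, bounds `ζᵀ Γ ζ` by `-c ‖ζ‖²`
(`exists_quadForm_le_of_isRightComplement`). Hence `V` is nonincreasing on `[τ, ∞)` and
`∫_τ^∞ ‖ζ‖²` is finite (`lyapunov_add_integral_le`).

Since `V` dominates a multiple of `‖x‖²`, and `V τ` is controlled by the initial function through
Grönwall's inequality on `[0, h]` (`exists_norm_extend_le`, `exists_lyapunov_le`), the zero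
solution is Lyapunov stable. Since `x` and `x'` are both square integrable, each square `xᵢ²` is
integrable with integrable derivative and so tends to zero (`tendsto_zero_of_integral_sq_le`).

The derivative `x'` may fail to exist before time `0`; it is replaced by the right-hand side of
the equation, evaluated on the extension of `x` that is constant on `(-∞, -h]`. The resulting
functions are continuous on the whole line, and only times `t > τ`, whose window lies in
`(0, ∞)`, enter the decay estimate. For `h = 0` all windows are trivial and the argument is the
one for `V = xᵀ P x`.
-/

namespace TimeDelay

open Matrix MeasureTheory

/-! ### Quadratic forms -/

/-- The quadratic form `v ↦ vᵀ M v` of a real square matrix. -/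
def quadForm {ι : Type*} [Fintype ι] (M : Matrix ι ι ℝ) (v : ι → ℝ) : ℝ := v ⬝ᵥ M *ᵥ v

section QuadForm

variable {ι κ : Type*} [Fintype ι] [Fintype κ]

theorem continuous_quadForm (M : Matrix ι ι ℝ) : Continuous (quadForm M) :=
  Continuous.dotProduct continuous_id (Continuous.matrix_mulVec continuous_const continuous_id)

theorem quadForm_smul (M : Matrix ι ι ℝ) (c : ℝ) (v : ι → ℝ) :
    quadForm M (c • v) = c ^ 2 * quadForm M v := by
  simp only [quadForm, mulVec_smul, smul_dotProduct, dotProduct_smul, smul_eq_mul]; ring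

theorem quadForm_add (M N : Matrix ι ι ℝ) (v : ι → ℝ) :
    quadForm (M + N) v = quadForm M v + quadForm N v := by
  simp only [quadForm, add_mulVec, dotProduct_add]

theorem quadForm_neg (M : Matrix ι ι ℝ) (v : ι → ℝ) : quadForm (-M) v = -quadForm M v := by
  simp only [quadForm, neg_mulVec, dotProduct_neg]

theorem quadForm_transpose_mul_mul (M : Matrix ι ι ℝ) (B : Matrix ι κ ℝ) (v : κ → ℝ) :
    quadForm (Bᵀ * M * B) v = quadForm M (B *ᵥ v) := by
  simp only [quadForm, ← mulVec_mulVec]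
  rw [dotProduct_mulVec, vecMul_transpose]

theorem dotProduct_mulVec_comm_of_isHermitian {M : Matrix ι ι ℝ} (hM : M.IsHermitian)
    (v w : ι → ℝ) : v ⬝ᵥ M *ᵥ w = w ⬝ᵥ M *ᵥ v := by
  have hT : Mᵀ = M := (conjTranspose_eq_transpose_of_trivial M).symm.trans hM
  rw [dotProduct_mulVec, ← mulVec_transpose, hT, dotProduct_comm]

theorem quadForm_sub {M : Matrix ι ι ℝ} (hM : M.IsHermitian) (v w : ι → ℝ) :
    quadForm M (v - w) = quadForm M v - 2 * (v ⬝ᵥ M *ᵥ w) + quadForm M w := by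
  simp only [quadForm, mulVec_sub, dotProduct_sub, sub_dotProduct]
  rw [dotProduct_mulVec_comm_of_isHermitian hM w v]; ring

theorem quadForm_pos {M : Matrix ι ι ℝ} (hM : M.PosDef) {v : ι → ℝ} (hv : v ≠ 0) :
    0 < quadForm M v := by
  simpa [quadForm] using hM.dotProduct_mulVec_pos hv

theorem quadForm_nonneg {M : Matrix ι ι ℝ} (hM : M.PosDef) (v : ι → ℝ) : 0 ≤ quadForm M v := by
  simpa [quadForm] using hM.posSemidef.dotProduct_mulVec_nonneg v

theorem exists_norm_mulVec_le (M : Matrix ι κ ℝ) :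
    ∃ c : ℝ, 0 ≤ c ∧ ∀ v : κ → ℝ, ‖M *ᵥ v‖ ≤ c * ‖v‖ :=
  ⟨‖M.mulVecLin.toContinuousLinearMap‖, norm_nonneg _,
    fun v => M.mulVecLin.toContinuousLinearMap.le_opNorm v⟩

theorem exists_abs_quadForm_le (M : Matrix ι ι ℝ) :
    ∃ c : ℝ, 0 ≤ c ∧ ∀ v : ι → ℝ, |quadForm M v| ≤ c * ‖v‖ ^ 2 := by
  obtain ⟨c, hc, h⟩ := exists_norm_mulVec_le M
  refine ⟨Fintype.card ι * c, by positivity, fun v => ?_⟩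
  calc |quadForm M v| ≤ ∑ i, |v i * (M *ᵥ v) i| := Finset.abs_sum_le_sum_abs _ _
    _ ≤ ∑ _i : ι, ‖v‖ * (c * ‖v‖) := by
        refine Finset.sum_le_sum fun i _ => ?_
        rw [abs_mul]
        exact mul_le_mul (norm_le_pi_norm v i) ((norm_le_pi_norm (M *ᵥ v) i).trans (h v))
          (abs_nonneg _) (norm_nonneg _)
    _ = Fintype.card ι * c * ‖v‖ ^ 2 := by
        rw [Finset.sum_const, Finset.card_univ, nsmul_eq_mul]; ring

/-- A quadratic form that is positive on the nonzero vectors of a subspace is coercive there,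
by compactness of the unit sphere. -/
theorem exists_le_quadForm_of_pos (M : Matrix ι ι ℝ) (W : Submodule ℝ (ι → ℝ))
    (h : ∀ v ∈ W, v ≠ 0 → 0 < quadForm M v) :
    ∃ c : ℝ, 0 < c ∧ ∀ v ∈ W, c * ‖v‖ ^ 2 ≤ quadForm M v := by
  have hK : IsCompact (Metric.sphere (0 : ι → ℝ) 1 ∩ W) :=
    (isCompact_sphere _ _).inter_right W.closed_of_finiteDimensional
  have unit : ∀ v ∈ W, v ≠ 0 → ‖v‖⁻¹ • v ∈ Metric.sphere (0 : ι → ℝ) 1 ∩ W := fun v hv hv0 =>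
    ⟨by simp [norm_smul, hv0], W.smul_mem _ hv⟩
  have main : ∃ c : ℝ, 0 < c ∧ ∀ v ∈ Metric.sphere (0 : ι → ℝ) 1 ∩ W, c ≤ quadForm M v := by
    rcases (Metric.sphere (0 : ι → ℝ) 1 ∩ W).eq_empty_or_nonempty with he | hne
    · exact ⟨1, one_pos, by simp [he]⟩
    · obtain ⟨w, hw, hmin⟩ := hK.exists_isMinOn hne (continuous_quadForm M).continuousOn
      refine ⟨quadForm M w, h w hw.2 ?_, fun v hv => hmin hv⟩
      rintro rfl
      simpa using hw.1
  obtain ⟨c, hc, hcv⟩ := main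
  refine ⟨c, hc, fun v hv => ?_⟩
  by_cases hv0 : v = 0
  · simp [hv0, quadForm]
  · have hn : 0 < ‖v‖ := norm_pos_iff.2 hv0
    have := hcv _ (unit v hv hv0)
    rw [quadForm_smul, inv_pow, inv_mul_eq_div, le_div_iff₀ (by positivity)] at this
    exact this

theorem hasDerivAt_quadForm {M : Matrix ι ι ℝ} (hM : M.IsHermitian) {v : ℝ → ι → ℝ}
    {v' : ι → ℝ} {t : ℝ} (hv : HasDerivAt v v' t) :
    HasDerivAt (fun s => quadForm M (v s)) (2 * (v' ⬝ᵥ M *ᵥ v t)) t := by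
  have hMv : HasDerivAt (fun s => M *ᵥ v s) (M *ᵥ v') t :=
    (M.mulVecLin.toContinuousLinearMap.hasFDerivAt).comp_hasDerivAt t hv
  rw [hasDerivAt_pi] at hv hMv
  have := HasDerivAt.fun_sum (u := Finset.univ) fun i _ => (hv i).mul (hMv i)
  refine this.congr_deriv ?_
  rw [Finset.sum_add_distrib, two_mul]
  exact congrArg _ (dotProduct_mulVec_comm_of_isHermitian hM (v t) v')

end QuadForm

/-! ### The matrix inequality on stacked vectors -/

/-- The form of a block matrix is the double sum over its blocks. -/
theorem quadForm_of_blocks {k n : ℕ} (B : ℕ → ℕ → Matrix (Fin n) (Fin n) ℝ)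
    (z : Fin k → Fin n → ℝ) :
    quadForm (Matrix.of fun a b : Fin k × Fin n => B a.1 b.1 a.2 b.2) (fun a => z a.1 a.2) =
      ∑ i : Fin k, ∑ j : Fin k, z i ⬝ᵥ B i j *ᵥ z j := by
  simp only [quadForm, dotProduct, mulVec, Fintype.sum_prod_type, of_apply]
  refine Finset.sum_congr rfl fun i _ => ?_
  rw [Finset.sum_comm]
  refine Finset.sum_congr rfl fun p _ => ?_
  rw [Finset.mul_sum]

theorem blockSelect_mulVec {n r k : ℕ} (hk : k ≤ 2) (z : Fin (r + 2) → Fin n → ℝ) :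
    blockSelect n r k *ᵥ (fun a => z a.1 a.2) =
      fun a : Fin r × Fin n => z ⟨a.1 + k, by omega⟩ a.2 := by
  funext a
  simp only [mulVec, dotProduct, blockSelect, of_apply, ite_mul, one_mul, zero_mul]
  rw [Finset.sum_eq_single (⟨⟨a.1 + k, by omega⟩, a.2⟩ : Fin (r + 2) × Fin n)]
  · simp
  · rintro ⟨b, c⟩ _ hb
    refine if_neg ?_
    rintro ⟨h1, h2⟩
    exact hb (Prod.ext (Fin.ext h1) h2)
  · simp

theorem quadForm_Gamma {n r : ℕ} (hr : 1 ≤ r) {P R : Matrix (Fin n) (Fin n) ℝ}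
    (hP : P.IsHermitian) (hR : R.IsHermitian) (Q : Matrix (Fin r × Fin n) (Fin r × Fin n) ℝ)
    (hm : ℝ) (z : Fin (r + 2) → Fin n → ℝ) :
    quadForm (Gamma P R Q hm) (fun a => z a.1 a.2) =
      hm / r * quadForm R (z 0) + 2 * (z 0 ⬝ᵥ P *ᵥ z ⟨1, by omega⟩)
        - r / hm * quadForm R (z ⟨1, by omega⟩ - z ⟨2, by omega⟩)
        + quadForm Q (fun a => z ⟨a.1 + 1, by omega⟩ a.2)
        - quadForm Q (fun a => z ⟨a.1 + 2, by omega⟩ a.2) := by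
  rw [Gamma, sub_eq_add_neg, quadForm_add, quadForm_add, quadForm_neg,
    quadForm_transpose_mul_mul, quadForm_transpose_mul_mul, blockSelect_mulVec (by norm_num),
    blockSelect_mulVec le_rfl, quadForm_of_blocks, quadForm_sub hR, ← sub_eq_add_neg]
  congr 2
  obtain ⟨k, rfl⟩ : ∃ k, r = k + 1 := ⟨r - 1, by omega⟩
  have h1 : (⟨1, by omega⟩ : Fin (k + 1 + 2)) = Fin.succ 0 := rfl
  have h2 : (⟨2, by omega⟩ : Fin (k + 1 + 2)) = Fin.succ (Fin.succ 0) := rfl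
  rw [h1, h2]
  simp only [Fin.sum_univ_succ (n := k + 2), Fin.sum_univ_succ (n := k + 1),
    Fin.sum_univ_succ (n := k), Fin.val_zero, Fin.val_succ, gammaBlock, zero_add]
  simp only [zero_mulVec, dotProduct_zero, Finset.sum_const_zero, add_zero, smul_mulVec,
    neg_mulVec, dotProduct_neg, dotProduct_smul, smul_eq_mul,
    quadForm, zero_add]
  rw [dotProduct_mulVec_comm_of_isHermitian hP (z (Fin.succ 0)) (z 0),
    dotProduct_mulVec_comm_of_isHermitian hR (z (Fin.succ (Fin.succ 0))) (z (Fin.succ 0))]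
  ring

theorem S_mulVec {n r : ℕ} (hr : 1 ≤ r) (A Ad : Matrix (Fin n) (Fin n) ℝ)
    (z : Fin (r + 2) → Fin n → ℝ) :
    S r A Ad *ᵥ (fun a => z a.1 a.2) =
      -z 0 + A *ᵥ z ⟨1, by omega⟩ + Ad *ᵥ z (Fin.last (r + 1)) := by
  obtain ⟨k, rfl⟩ : ∃ k, r = k + 1 := ⟨r - 1, by omega⟩
  have h1 : (⟨1, by omega⟩ : Fin (k + 1 + 2)) = Fin.succ 0 := rfl
  funext i
  rw [h1, ← Fin.succ_last, ← Fin.succ_last]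
  simp only [mulVec, dotProduct, S, of_apply, Fintype.sum_prod_type, Pi.add_apply, Pi.neg_apply]
  rw [Fin.sum_univ_succ, Fin.sum_univ_succ, Fin.sum_univ_castSucc]
  have h0 : ∀ x : Fin k, (x : ℕ) ≠ k := fun x => x.2.ne
  simp [Matrix.one_apply, h0]
  ring

/-- Negative definiteness of `Nᵀ Γ N`, the columns of `N` being a basis of the kernel of `M`,
gives a uniform negative bound for the form of `Γ` on that kernel. -/
theorem exists_quadForm_le_of_isRightComplement {m : ℕ} {ι κ : Type*} [Fintype κ]
    {M : Matrix ι κ ℝ} {N : Matrix κ (Fin m) ℝ} (hN : IsRightComplement M N)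
    {G : Matrix κ κ ℝ} (hG : (-(Nᵀ * G * N)).PosDef) :
    ∃ c : ℝ, 0 < c ∧ ∀ v : κ → ℝ, M *ᵥ v = 0 → quadForm G v ≤ -(c * ‖v‖ ^ 2) := by
  obtain ⟨c, hc, h⟩ := exists_le_quadForm_of_pos (-G) (LinearMap.ker M.mulVecLin) <| by
    intro v hv hv0
    rw [← hN.2, ← range_mulVecLin] at hv
    obtain ⟨w, rfl⟩ := hv
    have hw : w ≠ 0 := by rintro rfl; exact hv0 (map_zero _)
    have := quadForm_pos hG hw
    rwa [quadForm_neg, quadForm_transpose_mul_mul, ← quadForm_neg] at this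
  refine ⟨c, hc, fun v hv => ?_⟩
  have := h v (by simpa using hv)
  rw [quadForm_neg] at this
  linarith

/-! ### Integrals over a moving window -/

theorem hasDerivAt_integral_window {f : ℝ → ℝ} (hf : Continuous f) (τ t : ℝ) :
    HasDerivAt (fun t => ∫ s in (t - τ)..t, f s) (f t - f (t - τ)) t := by
  have hF : ∀ u, HasDerivAt (fun u => ∫ s in (0 : ℝ)..u, f s) (f u) u := fun u =>
    intervalIntegral.integral_hasDerivAt_right (hf.intervalIntegrable _ _)
      hf.aestronglyMeasurable.stronglyMeasurableAtFilter hf.continuousAt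
  have h := (hF t).sub ((hF (t - τ)).comp_sub_const t τ)
  refine h.congr_of_eventuallyEq (Eventually.of_forall fun u => ?_)
  exact (intervalIntegral.integral_interval_sub_left (hf.intervalIntegrable _ _)
    (hf.intervalIntegrable _ _)).symm

theorem hasDerivAt_integral_window_weighted {f : ℝ → ℝ} (hf : Continuous f) (τ t : ℝ) :
    HasDerivAt (fun t => ∫ s in (t - τ)..t, (s - (t - τ)) * f s)
      (τ * f t - ∫ s in (t - τ)..t, f s) t := by
  have hg : Continuous fun s => s * f s := continuous_id.mul hf
  have hcf : ∀ c : ℝ, Continuous fun s => c * f s := fun c => continuous_const.mul hf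
  have h := (hasDerivAt_integral_window hg τ t).sub
    (((hasDerivAt_id t).sub_const τ).mul (hasDerivAt_integral_window hf τ t))
  refine (h.congr_of_eventuallyEq (Eventually.of_forall fun u => ?_)).congr_deriv ?_
  · simp only [sub_mul (_ : ℝ) (_ - _) (f _)]
    rw [intervalIntegral.integral_sub (hg.intervalIntegrable _ _)
      ((hcf (u - τ)).intervalIntegrable _ _), intervalIntegral.integral_const_mul]
    rfl
  · simp only [id]; ring

/-! ### The Lyapunov–Krasovskii functional -/

/-- The `r` past values `y t, y (t - τ), …, y (t - (r - 1) τ)` stacked into one vector. -/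
def stack {n : ℕ} (r : ℕ) (y : ℝ → Fin n → ℝ) (τ t : ℝ) : Fin r × Fin n → ℝ :=
  fun a => y (t - (a.1 : ℕ) * τ) a.2

/-- The blocks `d t, y t, y (t - τ), …, y (t - r τ)`, to which `S` and `Γ` apply. -/
def augmented {n : ℕ} (r : ℕ) (y d : ℝ → Fin n → ℝ) (τ t : ℝ) : Fin (r + 2) → Fin n → ℝ :=
  Fin.cons (d t) fun k => y (t - (k : ℕ) * τ)

/-- The vector with blocks `augmented`. -/
def augmentedVec {n : ℕ} (r : ℕ) (y d : ℝ → Fin n → ℝ) (τ t : ℝ) : Fin (r + 2) × Fin n → ℝ :=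
  fun a => augmented r y d τ t a.1 a.2

/-- The Lyapunov–Krasovskii functional along a trajectory `y` with derivative `d`. The weighted
integral is the usual double integral of `dᵀ R d` over `t + θ ≤ s ≤ t`, `-τ ≤ θ ≤ 0`. -/
noncomputable def lyapunov {n r : ℕ} (P R : Matrix (Fin n) (Fin n) ℝ)
    (Q : Matrix (Fin r × Fin n) (Fin r × Fin n) ℝ) (τ : ℝ) (y d : ℝ → Fin n → ℝ) (t : ℝ) : ℝ :=
  quadForm P (y t) + (∫ s in (t - τ)..t, quadForm Q (stack r y τ s))
    + ∫ s in (t - τ)..t, (s - (t - τ)) * quadForm R (d s)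

section Functional

variable {n r : ℕ} {y d : ℝ → Fin n → ℝ} {P R : Matrix (Fin n) (Fin n) ℝ}
  {Q : Matrix (Fin r × Fin n) (Fin r × Fin n) ℝ} {τ hm t : ℝ}

theorem continuous_stack (hy : Continuous y) (τ : ℝ) : Continuous (stack r y τ) :=
  continuous_pi fun a => (continuous_apply a.2).comp (hy.comp (by fun_prop))

theorem continuous_augmentedVec (hy : Continuous y) (hd : Continuous d) (τ : ℝ) :
    Continuous (augmentedVec r y d τ) := by
  refine continuous_pi fun a => (continuous_apply a.2).comp ?_
  generalize a.1 = k
  cases k using Fin.cases with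
  | zero => exact hd
  | succ k => exact hy.comp (by fun_prop)

theorem norm_apply_zero_le (t τ : ℝ) : ‖d t‖ ≤ ‖augmentedVec r y d τ t‖ :=
  (pi_norm_le_iff_of_nonneg (norm_nonneg _)).2 fun i =>
    norm_le_pi_norm (augmentedVec r y d τ t) (0, i)

theorem norm_apply_one_le (t τ : ℝ) : ‖y t‖ ≤ ‖augmentedVec r y d τ t‖ := by
  refine (pi_norm_le_iff_of_nonneg (norm_nonneg _)).2 fun i => ?_
  have := norm_le_pi_norm (augmentedVec r y d τ t) (Fin.succ 0, i)
  simpa [augmentedVec, augmented] using this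

theorem quadForm_le_lyapunov (hR : R.PosDef) (hQ : Q.PosDef) (hτ : 0 ≤ τ) :
    quadForm P (y t) ≤ lyapunov P R Q τ y d t := by
  have h1 : 0 ≤ ∫ s in (t - τ)..t, quadForm Q (stack r y τ s) :=
    intervalIntegral.integral_nonneg (by linarith) fun s _ => quadForm_nonneg hQ _
  have h2 : 0 ≤ ∫ s in (t - τ)..t, (s - (t - τ)) * quadForm R (d s) :=
    intervalIntegral.integral_nonneg (by linarith) fun s hs =>
      mul_nonneg (sub_nonneg.2 hs.1) (quadForm_nonneg hR _)
  unfold lyapunov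
  linarith

theorem hasDerivAt_lyapunov (hP : P.IsHermitian) (hy : Continuous y) (hd : Continuous d)
    (hyd : HasDerivAt y (d t) t) :
    HasDerivAt (lyapunov P R Q τ y d)
      (2 * (d t ⬝ᵥ P *ᵥ y t)
        + (quadForm Q (stack r y τ t) - quadForm Q (stack r y τ (t - τ)))
        + (τ * quadForm R (d t) - ∫ s in (t - τ)..t, quadForm R (d s))) t :=
  ((hasDerivAt_quadForm hP hyd).add
    (hasDerivAt_integral_window ((continuous_quadForm Q).comp (continuous_stack hy τ)) τ t)).add
    (hasDerivAt_integral_window_weighted ((continuous_quadForm R).comp hd) τ t)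

theorem continuous_lyapunov (hy : Continuous y) (hd : Continuous d) :
    Continuous (lyapunov P R Q τ y d) := by
  refine (((continuous_quadForm P).comp hy).add ?_).add ?_
  · exact continuous_iff_continuousAt.2 fun t => (hasDerivAt_integral_window
      ((continuous_quadForm Q).comp (continuous_stack hy τ)) τ t).continuousAt
  · exact continuous_iff_continuousAt.2 fun t => (hasDerivAt_integral_window_weighted
      ((continuous_quadForm R).comp hd) τ t).continuousAt

/-- Jensen's inequality for the form of `R`, with any weight `c ≤ 1 / τ` in place of `1 / τ`;
this form also covers `τ = 0`. -/
theorem mul_quadForm_sub_le_integral (hR : R.PosDef) (hy : Continuous y) (hd : Continuous d)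
    (hτ : 0 ≤ τ) (hyd : ∀ s ∈ Ioo (t - τ) t, HasDerivAt y (d s) s) {c : ℝ} (hc : 0 ≤ c)
    (hcτ : c * τ ≤ 1) :
    c * quadForm R (y t - y (t - τ)) ≤ ∫ s in (t - τ)..t, quadForm R (d s) := by
  set Δ := y t - y (t - τ) with hΔ
  have hcont : ∀ {u : ℝ → Fin n → ℝ}, Continuous u → Continuous fun s => u s ⬝ᵥ R *ᵥ Δ :=
    fun hu => hu.dotProduct continuous_const
  have hlin : Continuous fun s => 2 * c * (d s ⬝ᵥ R *ᵥ Δ) := continuous_const.mul (hcont hd)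
  -- The integrand is bounded below by its tangent at the vector `c • Δ`.
  have hpt : ∀ s, 2 * c * (d s ⬝ᵥ R *ᵥ Δ) - c ^ 2 * quadForm R Δ ≤ quadForm R (d s) := by
    intro s
    have := quadForm_nonneg hR (d s - c • Δ)
    rw [quadForm_sub hR.1, quadForm_smul, mulVec_smul, dotProduct_smul, smul_eq_mul] at this
    linarith
  have hFTC : ∫ s in (t - τ)..t, d s ⬝ᵥ R *ᵥ Δ = quadForm R Δ := by
    rw [intervalIntegral.integral_eq_sub_of_hasDerivAt_of_le (f := fun s => y s ⬝ᵥ R *ᵥ Δ)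
      (by linarith) (hcont hy).continuousOn _ ((hcont hd).intervalIntegrable _ _)]
    · rw [← sub_dotProduct, ← hΔ]; rfl
    · intro s hs
      have h := hasDerivAt_pi.1 (hyd s hs)
      exact HasDerivAt.fun_sum (u := Finset.univ) fun i _ => (h i).mul_const ((R *ᵥ Δ) i)
  have hint : ∫ s in (t - τ)..t, (2 * c * (d s ⬝ᵥ R *ᵥ Δ) - c ^ 2 * quadForm R Δ)
      = 2 * c * quadForm R Δ - τ * (c ^ 2 * quadForm R Δ) := by
    rw [intervalIntegral.integral_sub (hlin.intervalIntegrable _ _)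
      (continuous_const.intervalIntegrable _ _), intervalIntegral.integral_const_mul, hFTC,
      intervalIntegral.integral_const, smul_eq_mul]
    ring
  have hle : ∫ s in (t - τ)..t, (2 * c * (d s ⬝ᵥ R *ᵥ Δ) - c ^ 2 * quadForm R Δ)
      ≤ ∫ s in (t - τ)..t, quadForm R (d s) :=
    intervalIntegral.integral_mono_on (by linarith)
      ((hlin.sub continuous_const).intervalIntegrable _ _)
      (((continuous_quadForm R).comp hd).intervalIntegrable _ _) fun s _ => hpt s
  rw [hint] at hle
  refine le_trans ?_ hle
  have h0 : 0 ≤ c * (1 - c * τ) * quadForm R Δ :=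
    mul_nonneg (mul_nonneg hc (by linarith)) (quadForm_nonneg hR _)
  linarith

/-- The derivative of the functional is at most the form of `Γ` at the augmented vector. -/
theorem deriv_lyapunov_le_quadForm_Gamma (hr : 1 ≤ r) (hP : P.IsHermitian) (hR : R.PosDef)
    (hy : Continuous y) (hd : Continuous d) (hm_pos : 0 < hm) (hτ : 0 ≤ τ) (hτm : r * τ ≤ hm)
    (hyd : ∀ s > 0, HasDerivAt y (d s) s) (ht : τ < t) :
    deriv (lyapunov P R Q τ y d) t ≤ quadForm (Gamma P R Q hm) (augmentedVec r y d τ t) := by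
  have hr0 : (0 : ℝ) < r := by exact_mod_cast hr
  rw [(hasDerivAt_lyapunov hP hy hd (hyd t (hτ.trans_lt ht))).deriv]
  have hJ := mul_quadForm_sub_le_integral hR hy hd hτ
    (fun s hs => hyd s (by have := hs.1; linarith)) (c := r / hm) (by positivity)
    (by rw [div_mul_eq_mul_div]; exact div_le_one_of_le₀ hτm hm_pos.le)
  have hτR : τ * quadForm R (d t) ≤ hm / r * quadForm R (d t) :=
    mul_le_mul_of_nonneg_right (by rw [le_div_iff₀ hr0]; linarith) (quadForm_nonneg hR _)
  have h0 : augmented r y d τ t 0 = d t := rfl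
  have hsucc : ∀ (k : ℕ) (hk : k + 1 < r + 2),
      augmented r y d τ t ⟨k + 1, hk⟩ = y (t - k * τ) := fun k hk => rfl
  have h1 : augmented r y d τ t ⟨1, by omega⟩ = y t := by
    rw [hsucc 0 (by omega)]; simp
  have h2 : augmented r y d τ t ⟨2, by omega⟩ = y (t - τ) := by
    rw [hsucc 1 (by omega)]; simp
  have hs1 : (fun a : Fin r × Fin n => augmented r y d τ t ⟨a.1 + 1, by omega⟩ a.2)
      = stack r y τ t := rfl
  have hs2 : (fun a : Fin r × Fin n => augmented r y d τ t ⟨a.1 + 2, by omega⟩ a.2)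
      = stack r y τ (t - τ) := by
    funext a
    rw [hsucc (a.1 + 1) (by omega), stack]
    have : t - ((a.1 + 1 : ℕ) : ℝ) * τ = t - τ - (a.1 : ℕ) * τ := by push_cast; ring
    rw [this]
  have hG := quadForm_Gamma hr hP hR.1 Q hm (augmented r y d τ t)
  rw [h0, h1, h2, hs1, hs2] at hG
  unfold augmentedVec
  rw [hG]
  linarith

theorem S_mulVec_augmentedVec (hr : 1 ≤ r) {A Ad : Matrix (Fin n) (Fin n) ℝ}
    (hd : d t = A *ᵥ y t + Ad *ᵥ y (t - r * τ)) :
    S r A Ad *ᵥ augmentedVec r y d τ t = 0 := by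
  have hsucc : ∀ (k : ℕ) (hk : k + 1 < r + 2),
      augmented r y d τ t ⟨k + 1, hk⟩ = y (t - k * τ) := fun k hk => rfl
  have h0 : augmented r y d τ t 0 = d t := rfl
  unfold augmentedVec
  rw [S_mulVec hr, h0, Fin.last, hsucc 0 (by omega), hsucc r (by omega), hd]
  simp [add_assoc]

/-- Dissipation: a bound `V' ≤ -c |ζ|²`, with `ζ` the augmented vector, integrated. -/
theorem lyapunov_add_integral_le {c : ℝ} (hP : P.IsHermitian) (hy : Continuous y)
    (hd : Continuous d) (hτ : 0 ≤ τ) (hyd : ∀ s > 0, HasDerivAt y (d s) s)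
    (hV : ∀ t > τ, deriv (lyapunov P R Q τ y d) t ≤ -(c * ‖augmentedVec r y d τ t‖ ^ 2))
    (ht : τ ≤ t) :
    lyapunov P R Q τ y d t + c * ∫ s in τ..t, ‖augmentedVec r y d τ s‖ ^ 2
      ≤ lyapunov P R Q τ y d τ := by
  have hz : Continuous fun s => ‖augmentedVec r y d τ s‖ ^ 2 :=
    (continuous_augmentedVec hy hd τ).norm.pow 2
  have hI : ∀ u, HasDerivAt (fun u => c * ∫ s in τ..u, ‖augmentedVec r y d τ s‖ ^ 2)
      (c * ‖augmentedVec r y d τ u‖ ^ 2) u := fun u =>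
    (intervalIntegral.integral_hasDerivAt_right (hz.intervalIntegrable _ _)
      hz.aestronglyMeasurable.stronglyMeasurableAtFilter hz.continuousAt).const_mul c
  have hVd : ∀ u > τ, DifferentiableAt ℝ (lyapunov P R Q τ y d) u := fun u hu =>
    (hasDerivAt_lyapunov hP hy hd (hyd u (hτ.trans_lt hu))).differentiableAt
  have hanti := antitoneOn_of_deriv_nonpos (convex_Ici τ)
    (f := fun u => lyapunov P R Q τ y d u + c * ∫ s in τ..u, ‖augmentedVec r y d τ s‖ ^ 2)
    ((continuous_lyapunov hy hd).add
      (continuous_iff_continuousAt.2 fun u => (hI u).continuousAt)).continuousOn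
    (fun u hu => by
      rw [interior_Ici] at hu
      exact ((hVd u hu).add (hI u).differentiableAt).differentiableWithinAt)
    (fun u hu => by
      rw [interior_Ici] at hu
      have h := ((hVd u hu).hasDerivAt.add (hI u)).deriv
      have h' := hV u hu
      refine h.le.trans ?_
      linarith)
  simpa using hanti self_mem_Ici ht ht

/-- A bound `M` on the past trajectory bounds the functional by a multiple of `M ^ 2`. -/
theorem exists_lyapunov_le (P R : Matrix (Fin n) (Fin n) ℝ)
    (Q : Matrix (Fin r × Fin n) (Fin r × Fin n) ℝ) (hτ : 0 ≤ τ) (L : ℝ) :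
    ∃ K : ℝ, 0 ≤ K ∧ ∀ (y d : ℝ → Fin n → ℝ) (t M : ℝ), 0 ≤ M → (∀ s ≤ t, ‖y s‖ ≤ M) →
      (∀ s ∈ Icc (t - τ) t, ‖d s‖ ≤ L * M) → lyapunov P R Q τ y d t ≤ K * M ^ 2 := by
  obtain ⟨p, hp, hP⟩ := exists_abs_quadForm_le P
  obtain ⟨q, hq, hQ⟩ := exists_abs_quadForm_le Q
  obtain ⟨ρ, hρ, hR⟩ := exists_abs_quadForm_le R
  refine ⟨p + τ * q + τ * (τ * (ρ * L ^ 2)), by positivity, fun y d t M hM hy hd => ?_⟩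
  have h1 : quadForm P (y t) ≤ p * M ^ 2 :=
    (le_abs_self _).trans <| (hP _).trans <| by gcongr; exact hy t le_rfl
  have h2 : ∫ s in (t - τ)..t, quadForm Q (stack r y τ s) ≤ q * M ^ 2 * |t - (t - τ)| := by
    refine (Real.le_norm_self _).trans (intervalIntegral.norm_integral_le_of_norm_le_const ?_)
    intro s hs
    rw [uIoc_of_le (by linarith)] at hs
    refine (hQ _).trans ?_
    gcongr
    refine (pi_norm_le_iff_of_nonneg hM).2 fun a => (norm_le_pi_norm (y _) a.2).trans (hy _ ?_)
    have : 0 ≤ (a.1 : ℕ) * τ := by positivity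
    linarith [hs.2]
  have h3 : ∫ s in (t - τ)..t, (s - (t - τ)) * quadForm R (d s)
      ≤ τ * (ρ * (L * M) ^ 2) * |t - (t - τ)| := by
    refine (Real.le_norm_self _).trans (intervalIntegral.norm_integral_le_of_norm_le_const ?_)
    intro s hs
    rw [uIoc_of_le (by linarith)] at hs
    rw [norm_mul, Real.norm_of_nonneg (by linarith [hs.1])]
    refine mul_le_mul (by linarith [hs.2]) ((hR _).trans ?_) (norm_nonneg _) hτ
    gcongr
    exact hd s ⟨hs.1.le, hs.2⟩
  rw [sub_sub_cancel, abs_of_nonneg hτ] at h2 h3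
  unfold lyapunov
  linarith

end Functional

/-! ### Stability -/

/-- The extension of a solution to a continuous function on the line, constant before `-h`. -/
noncomputable def extend {n : ℕ} (h : ℝ) (x : ℝ → Fin n → ℝ) (s : ℝ) : Fin n → ℝ := x (max s (-h))

section Solution

variable {n : ℕ} {A Ad : Matrix (Fin n) (Fin n) ℝ} {h : ℝ} {φ x : ℝ → Fin n → ℝ}

theorem extend_eq {s : ℝ} (hs : -h ≤ s) : extend h x s = x s := by rw [extend, max_eq_left hs]

theorem IsSolution.continuous_extend (hx : IsSolution A Ad h φ x) : Continuous (extend h x) :=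
  hx.continuousOn.comp_continuous (by fun_prop) fun s => le_max_right s (-h)

theorem IsSolution.hasDerivAt_extend (hx : IsSolution A Ad h φ x) (hh : 0 ≤ h) {t : ℝ}
    (ht : 0 < t) :
    HasDerivAt (extend h x) (A *ᵥ extend h x t + Ad *ᵥ extend h x (t - h)) t := by
  rw [extend_eq (by linarith), extend_eq (by linarith)]
  refine ((hx.hasDeriv t ht.le).hasDerivAt (Ici_mem_nhds ht)).congr_of_eventuallyEq ?_
  filter_upwards [Ioi_mem_nhds ht] with s hs
  exact extend_eq (by linarith [mem_Ioi.1 hs])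

/-- On the first delay interval the delayed term is known, and Grönwall's inequality applies. -/
theorem exists_norm_extend_le (A Ad : Matrix (Fin n) (Fin n) ℝ) (hh : 0 ≤ h) :
    ∃ C : ℝ, 0 ≤ C ∧ ∀ (φ x : ℝ → Fin n → ℝ) (M : ℝ), IsSolution A Ad h φ x → 0 ≤ M →
      (∀ θ ∈ Icc (-h) 0, ‖φ θ‖ ≤ M) → ∀ s ≤ h, ‖extend h x s‖ ≤ C * M := by
  obtain ⟨a, ha, hA⟩ := exists_norm_mulVec_le A
  obtain ⟨b, hb, hAd⟩ := exists_norm_mulVec_le Ad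
  -- The growth rate `a + 1` is nonzero, and `ε / (a + 1) ≤ ε` in Grönwall's bound.
  refine ⟨(1 + b) * Real.exp ((a + 1) * h), by positivity, fun φ x M hx hM hφ s hs => ?_⟩
  have hpast : ∀ s ∈ Icc (-h) 0, ‖x s‖ ≤ M := fun s hs => by rw [hx.initial s hs]; exact hφ s hs
  have hexp : 1 ≤ Real.exp ((a + 1) * h) := Real.one_le_exp (by positivity)
  have hbig : M ≤ (1 + b) * Real.exp ((a + 1) * h) * M :=
    le_mul_of_one_le_left hM (one_le_mul_of_one_le_of_one_le (by linarith) hexp)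
  rcases le_or_gt s 0 with h0 | h0
  · exact (hpast _ ⟨le_max_right _ _, max_le h0 (by linarith)⟩).trans hbig
  rw [extend_eq (by linarith)]
  have hG := norm_le_gronwallBound_of_norm_deriv_right_le (f := x) (a := 0) (b := h) (δ := M)
    (K := a + 1) (ε := b * M)
    (hx.continuousOn.mono fun u hu => by simp only [mem_Ici]; linarith [hu.1])
    (fun u hu => (hx.hasDeriv u hu.1).mono (Ici_subset_Ici.2 hu.1))
    (hpast 0 ⟨by linarith, le_rfl⟩)
    (fun u hu => by
      have h1 := hAd (x (u - h))
      have h2 := mul_le_mul_of_nonneg_left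
        (hpast (u - h) ⟨by linarith [hu.1], by linarith [hu.2]⟩) hb
      have h3 := norm_add_le (A *ᵥ x u) (Ad *ᵥ x (u - h))
      have h4 := hA (x u)
      have h5 := norm_nonneg (x u)
      linarith)
    s ⟨h0.le, hs⟩
  rw [gronwallBound_of_K_ne_0 (by positivity), sub_zero] at hG
  refine hG.trans ?_
  have hes : Real.exp ((a + 1) * s) ≤ Real.exp ((a + 1) * h) := by gcongr
  have hdiv : b * M / (a + 1) ≤ b * M := div_le_self (by positivity) (by linarith)
  have he1 : 1 ≤ Real.exp ((a + 1) * s) := Real.one_le_exp (by positivity)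
  calc M * Real.exp ((a + 1) * s) + b * M / (a + 1) * (Real.exp ((a + 1) * s) - 1)
      ≤ M * Real.exp ((a + 1) * h) + b * M * Real.exp ((a + 1) * h) := by
        gcongr
        linarith
    _ = _ := by ring

end Solution

/-- A differentiable function that is square integrable together with its derivative tends to
zero. The square integrability is expressed through a common majorant `g`. -/
theorem tendsto_zero_of_integral_sq_le {n : ℕ} {y d : ℝ → Fin n → ℝ} {g : ℝ → ℝ} {a I : ℝ}
    (hy : Continuous y) (hd : Continuous d) (hg : Continuous g)
    (hyd : ∀ t > a, HasDerivAt y (d t) t) (hyg : ∀ t, ‖y t‖ ≤ g t) (hdg : ∀ t, ‖d t‖ ≤ g t)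
    (hI : ∀ t ≥ a, ∫ s in a..t, g s ^ 2 ≤ I) :
    Tendsto y atTop (𝓝 0) := by
  have hgi : IntegrableOn (fun s => g s ^ 2) (Ioi a) := by
    refine integrableOn_Ioi_of_intervalIntegral_norm_bounded (b := id) (l := atTop) I a
      (fun t => (hg.pow 2).continuousOn.integrableOn_Icc.mono_set Ioc_subset_Icc_self)
      tendsto_id ?_
    filter_upwards [eventually_ge_atTop a] with t ht
    simpa using hI t ht
  rw [tendsto_pi_nhds]
  intro i
  have hyi : Continuous fun s => y s i := (continuous_apply i).comp hy
  have hdi : Continuous fun s => d s i := (continuous_apply i).comp hd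
  have hyb : ∀ s, |y s i| ≤ g s := fun s => (norm_le_pi_norm (y s) i).trans (hyg s)
  have hdb : ∀ s, |d s i| ≤ g s := fun s => (norm_le_pi_norm (d s) i).trans (hdg s)
  have hsq : Tendsto (fun s => y s i ^ 2) atTop (𝓝 0) := by
    refine tendsto_zero_of_hasDerivAt_of_integrableOn_Ioi (a := a)
      (f' := fun s => 2 * (y s i * d s i)) (fun s hs => ?_) ?_ ?_
    · exact ((hasDerivAt_pi.1 (hyd s hs) i).pow 2).congr_deriv (by simp; ring)
    · refine Integrable.mono' (hgi.const_mul 2)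
        (continuous_const.mul (hyi.mul hdi)).aestronglyMeasurable
        (Eventually.of_forall fun s => ?_)
      rw [Real.norm_eq_abs, abs_mul, abs_mul, abs_two, sq]
      exact mul_le_mul_of_nonneg_left (mul_le_mul (hyb s) (hdb s) (abs_nonneg _)
        ((abs_nonneg _).trans (hyb s))) zero_le_two
    · refine Integrable.mono' hgi (hyi.pow 2).aestronglyMeasurable
        (Eventually.of_forall fun s => ?_)
      rw [Real.norm_eq_abs, abs_pow]
      exact pow_le_pow_left₀ (abs_nonneg _) (hyb s) 2
  refine (tendsto_zero_iff_abs_tendsto_zero _).2 ?_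
  have := (Real.continuous_sqrt.tendsto 0).comp hsq
  simpa [Function.comp_def, Real.sqrt_sq_eq_abs] using this

end TimeDelay

theorem proposition1 {n r m : ℕ} (hr : 1 ≤ r)
    (A Ad P R : Matrix (Fin n) (Fin n) ℝ)
    (Q : Matrix (Fin r × Fin n) (Fin r × Fin n) ℝ) (hm : ℝ)
    (hP : P.PosDef) (hR : R.PosDef) (hQ : Q.PosDef) (hm_pos : 0 < hm)
    (Sperp : Matrix (Fin (r + 2) × Fin n) (Fin m) ℝ)
    (hSperp : TimeDelay.IsRightComplement (TimeDelay.S r A Ad) Sperp)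
    (hLMI : (-(Sperp.transpose * TimeDelay.Gamma P R Q hm * Sperp)).PosDef) :
    ∀ h : ℝ, 0 ≤ h → h ≤ hm → TimeDelay.IsAsymptoticallyStable A Ad h := by
  open TimeDelay Matrix in
  intro h hh hhm
  have hr0 : (0 : ℝ) < r := by exact_mod_cast hr
  obtain ⟨τ, hτdef⟩ : ∃ τ, τ = h / r := ⟨_, rfl⟩
  have hτ : 0 ≤ τ := by rw [hτdef]; positivity
  have hrτ : r * τ = h := by rw [hτdef]; field_simp
  have hτh : τ ≤ h := by rw [hτdef]; exact div_le_self hh (by exact_mod_cast hr)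
  obtain ⟨c, hc, hcΓ⟩ := exists_quadForm_le_of_isRightComplement hSperp hLMI
  obtain ⟨p, hp, hpP⟩ := exists_le_quadForm_of_pos P ⊤ fun v _ hv => quadForm_pos hP hv
  obtain ⟨a, ha, hA⟩ := exists_norm_mulVec_le A
  obtain ⟨b, hb, hAd⟩ := exists_norm_mulVec_le Ad
  obtain ⟨C, hC, hCx⟩ := exists_norm_extend_le A Ad hh
  obtain ⟨K, hK, hKV⟩ := exists_lyapunov_le P R Q hτ (a + b)
  let D (x : ℝ → Fin n → ℝ) (s : ℝ) : Fin n → ℝ := A *ᵥ extend h x s + Ad *ᵥ extend h x (s - h)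
  have hD : ∀ {φ x}, IsSolution A Ad h φ x → Continuous (D x) := fun hx =>
    (continuous_const.matrix_mulVec hx.continuous_extend).add
      (continuous_const.matrix_mulVec (hx.continuous_extend.comp (by fun_prop)))
  have hdiss : ∀ {φ x}, IsSolution A Ad h φ x → ∀ t ≥ τ,
      lyapunov P R Q τ (extend h x) (D x) t
        + c * ∫ s in τ..t, ‖augmentedVec r (extend h x) (D x) τ s‖ ^ 2
        ≤ lyapunov P R Q τ (extend h x) (D x) τ := by
    intro φ x hx t ht
    refine lyapunov_add_integral_le hP.1 hx.continuous_extend (hD hx) hτ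
      (fun s hs => hx.hasDerivAt_extend hh hs) (fun s hs => ?_) ht
    refine (deriv_lyapunov_le_quadForm_Gamma hr hP.1 hR hx.continuous_extend (hD hx) hm_pos hτ
      (hrτ.trans_le hhm) (fun s hs => hx.hasDerivAt_extend hh hs) hs).trans (hcΓ _ ?_)
    exact S_mulVec_augmentedVec hr (by rw [hrτ])
  have hint_nonneg : ∀ (x : ℝ → Fin n → ℝ), ∀ t ≥ τ,
      0 ≤ ∫ s in τ..t, ‖augmentedVec r (extend h x) (D x) τ s‖ ^ 2 := fun x t ht =>
    intervalIntegral.integral_nonneg ht fun s _ => by positivity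
  refine ⟨fun ε hε => ?_, fun φ x hx => ?_⟩
  · -- A solution stays below `C * δ` up to time `h`, and below `√(K / p) * (C * δ)` after `τ`.
    refine ⟨ε / ((1 + √(K / p)) * C + 1), by positivity, fun φ x hx hφ t ht => ?_⟩
    set δ := ε / ((1 + √(K / p)) * C + 1) with hδdef
    have hδ : 0 < δ := by positivity
    have hδε : (1 + √(K / p)) * (C * δ) < ε := by
      have : ((1 + √(K / p)) * C + 1) * δ = ε := by rw [hδdef]; field_simp
      linarith
    have hsq : 0 ≤ √(K / p) * (C * δ) := by positivity
    have hCδ : 0 ≤ C * δ := by positivity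
    have hpast := hCx φ x δ hx hδ.le fun θ hθ => (hφ θ hθ).le
    rw [← extend_eq (h := h) (x := x) (by linarith)]
    rcases le_or_gt t h with hth | hth
    · exact (hpast t hth).trans_lt (by linarith)
    have hVτ := hKV (extend h x) (D x) τ (C * δ) hCδ (fun s hs => hpast s (hs.trans hτh))
      fun s hs => by
        have h1 := norm_add_le (A *ᵥ extend h x s) (Ad *ᵥ extend h x (s - h))
        have h2 := (hA (extend h x s)).trans
          (mul_le_mul_of_nonneg_left (hpast s (hs.2.trans hτh)) ha)
        have h3 := (hAd (extend h x (s - h))).trans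
          (mul_le_mul_of_nonneg_left (hpast (s - h) (by linarith [hs.2])) hb)
        change ‖A *ᵥ extend h x s + Ad *ᵥ extend h x (s - h)‖ ≤ _
        linarith
    have hlow := hpP (extend h x t) trivial
    have hVt := quadForm_le_lyapunov (P := P) (y := extend h x) (d := D x) (t := t) hR hQ hτ
    have hdec := hdiss hx t (hτh.trans hth.le)
    have hnn := mul_nonneg hc.le (hint_nonneg x t (hτh.trans hth.le))
    have hfin : ‖extend h x t‖ ^ 2 ≤ (√(K / p) * (C * δ)) ^ 2 := by
      rw [mul_pow, Real.sq_sqrt (by positivity), div_mul_eq_mul_div, le_div_iff₀ hp]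
      linarith
    exact (le_of_sq_le_sq hfin hsq).trans_lt (by linarith)
  · have hlim : Tendsto (extend h x) atTop (𝓝 0) := by
      refine tendsto_zero_of_integral_sq_le (a := τ) (d := D x)
        (I := lyapunov P R Q τ (extend h x) (D x) τ / c)
        (g := fun s => ‖augmentedVec r (extend h x) (D x) τ s‖)
        hx.continuous_extend (hD hx) (continuous_augmentedVec hx.continuous_extend (hD hx) τ).norm
        (fun t ht => hx.hasDerivAt_extend hh (hτ.trans_lt ht))
        (fun t => norm_apply_one_le t τ) (fun t => norm_apply_zero_le t τ) fun t ht => ?_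
      rw [le_div_iff₀ hc]
      have h1 := hdiss hx t ht
      have h2 := quadForm_le_lyapunov (P := P) (y := extend h x) (d := D x) (t := t) hR hQ hτ
      have h3 := quadForm_nonneg hP (extend h x t)
      linarith
    refine hlim.congr' ?_
    filter_upwards [eventually_ge_atTop (-h)] with s hs
    exact extend_eq hs
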